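/- Fix a finite alphabet $\Sigma$. A multiple context-free grammar over $\Sigma$ consists of a finite set $N$ of non-terminals, each $A\in N$ having a rank $\operatorname{rk}(A)$ (its number of arguments), a start non-terminal $S\in N$ of rank $1$, and a finite set of rules of the form $$A(s_1,\dots,s_p)\leftarrow B_1(x^1_1,\dots,x^1_{k_1}),\dots,B_q(x^q_1,\dots,x^q_{k_q}),$$ where $q\ge 0$, $A,B_1,\dots,B_q\in N$, $p=\operatorname{rk}(A)$, $k_i=\operatorname{rk}(B_i)$, the variables $x^i_j$ are distinct, and $s_1,\dots,s_p$ are strings of letters of $\Sigma$ and variables $x^i_j$ such that each variable occurs at most once in the concatenation $s_1\cdots s_p$. Such a rule derives the tuple of words for $A$ that is obtained from $(s_1,\dots,s_p)$ by substituting for $x^i_1,\dots,x^i_{k_i}$ the components of a tuple already derived for $B_i$, for each $i=1,\dots,q$ (for $q=0$ it derives $(s_1,\dots,s_p)$ itself). The language of the grammar is the set of all words $w\in\Sigma^*$ such that $(w)$ can be derived for $S$ by finitely many applications of rules. For an integer $k\ge 1$, a language $L\subseteq\Sigma^*$ is $k$-multiple context-free if it is the language of a multiple context-free grammar all of whose non-terminals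 have rank at most $k$. **Lemma.** Let $m\ge 1$ be an integer and let $\Sigma=\{a_1,\dots,a_{2m+1}\}$ be an alphabet of size $2m+1$. Then the language $$S_m=\{a_1^n a_2^n\cdots a_{2m+1}^n : n\in\mathbb N,\ n\ge 0\}$$ is not $m$-multiple context-free. -/

import Mathlib

universe u

/-- A rule `A(s₁, …, s_m) ← B₁(x₁¹, …), …, B_n(x₁ⁿ, …)` over the terminals `T` and the non-terminals
`N`, where a non-terminal `A` has `rank A` arguments. The case `arity = 0` is `A(t₁, …, t_m) ←`. -/
structure MCFRule (T : Type u) {N : Type} (rank : N → ℕ) where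
  /-- the non-terminal `A` on the left -/
  head : N
  /-- the number `n` of non-terminals on the right -/
  arity : ℕ
  /-- the non-terminals `B₁, …, B_n` on the right, repetitions allowed -/
  body : Fin arity → N
  /-- the strings `s₁, …, s_m` of terminals and variables; the pair `⟨i, j⟩` is the variable that
  stands for the `j`-th component of the value of `B_i` -/
  output : Fin (rank head) → List (T ⊕ (Σ i : Fin arity, Fin (rank (body i))))
  /-- each variable occurs at most once in the concatenation `s₁ ⋯ s_m` -/
  linear : ((List.ofFn output).flatten.filterMap Sum.getRight?).Nodup

namespace MCFRule

variable {T : Type u} {N : Type} {rank : N → ℕ}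

/-- The value that a rule produces for its head out of values `v i` for the non-terminals `B_i`:
every variable in the strings `s_j` is replaced by its value. -/
def apply (r : MCFRule T rank) (v : (i : Fin r.arity) → Fin (rank (r.body i)) → List T) :
    Fin (rank r.head) → List T :=
  fun j => (r.output j).flatMap (Sum.elim (fun t => [t]) (fun x => v x.1 x.2))

end MCFRule

/-- Multiple context-free grammars with terminals in `T`. As there are finitely many non-terminals,
taking them in `Type` is no restriction. -/
structure MultipleContextFreeGrammar (T : Type u) where
  /-- the non-terminals -/
  NT : Type
  finite_NT : Finite NT
  /-- the number of arguments of a non-terminal -/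
  rank : NT → ℕ
  /-- the start non-terminal -/
  start : NT
  rank_start : rank start = 1
  /-- the finite set of rules -/
  rules : Finset (MCFRule T rank)

namespace MultipleContextFreeGrammar

variable {T : Type u}

/-- `g.Derives A v` says that the tuple of words `v` is obtained as a value of the non-terminal `A`
by finitely many applications of rules of `g`. -/
inductive Derives (g : MultipleContextFreeGrammar T) :
    (A : g.NT) → (Fin (g.rank A) → List T) → Prop
  | rule (r : MCFRule T g.rank) (hr : r ∈ g.rules)
      (v : (i : Fin r.arity) → Fin (g.rank (r.body i)) → List T)
      (hv : ∀ i, Derives g (r.body i) (v i)) : Derives g r.head (r.apply v)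

/-- The set of words `w` such that `S(w)` is derivable for the start non-terminal `S`
(which has a single argument). -/
def language (g : MultipleContextFreeGrammar T) : Language T :=
  {w | g.Derives g.start (fun _ => w)}

end MultipleContextFreeGrammar

/-- A language is `k`-multiple context-free if it is generated by a multiple context-free grammar
all of whose non-terminals have rank at most `k`. -/
def Language.IsMultipleContextFree {T : Type u} (k : ℕ) (L : Language T) : Prop :=
  ∃ g : MultipleContextFreeGrammar T, (∀ A : g.NT, g.rank A ≤ k) ∧ g.language = L

/-- The word `a₁ⁿ a₂ⁿ ⋯ a_kⁿ`. -/
def blockWord {T : Type u} {k : ℕ} (a : Fin k → T) (n : ℕ) : List T :=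
  (List.ofFn fun i => List.replicate n (a i)).flatten

/-! A node of a derivation splits the derived word into the letters of its value and those of the
surrounding context, a string with at most `m` distinct variables. Descending a derivation of a long
word yields splits with both parts arbitrarily long (`exists_long_context`). The two parts alternate
at most `2m` times, so among `2m + 1` blocks some letter misses one part (`exists_letter_not_mem`).
By pigeonhole, the non-terminal, the list of variables, the letter and the side it misses may be
fixed for all sizes. A context then accepts every value of its non-terminal, so a short part can be
exchanged for a long one. The missing letter is counted by the kept part alone, so both words have
the same exponent; hence the exchanged parts have equal length, a contradiction. -/

namespace LinearTemplate

/-! ### Strings of terminals and variables -/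

variable {T : Type*} {α β : Type*}

/-- The word obtained from a string of terminals and variables by assigning values to the
variables. -/
def fill (C : List (T ⊕ α)) (v : α → List T) : List T :=
  C.flatMap (Sum.elim (fun t => [t]) v)

/-- Simultaneous substitution of strings of terminals and variables for variables. -/
def subst (C : List (T ⊕ α)) (σ : α → List (T ⊕ β)) : List (T ⊕ β) :=
  C.flatMap (Sum.elim (fun t => [Sum.inl t]) σ)

/-- The variable occurrences of a string. -/
def vars (C : List (T ⊕ α)) : List α := C.filterMap Sum.getRight?

/-- The terminal occurrences of a string. -/
def terminals (C : List (T ⊕ α)) : List T := C.filterMap Sum.getLeft?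

@[simp] lemma fill_nil (v : α → List T) : fill [] v = [] := rfl

@[simp] lemma fill_inl (t : T) (C : List (T ⊕ α)) (v : α → List T) :
    fill (Sum.inl t :: C) v = t :: fill C v := rfl

@[simp] lemma fill_inr (x : α) (C : List (T ⊕ α)) (v : α → List T) :
    fill (Sum.inr x :: C) v = v x ++ fill C v := rfl

@[simp] lemma fill_append (C D : List (T ⊕ α)) (v : α → List T) :
    fill (C ++ D) v = fill C v ++ fill D v := by simp [fill]

@[simp] lemma fill_map_inl (w : List T) (v : α → List T) : fill (w.map Sum.inl) v = w := by
  induction w with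
  | nil => rfl
  | cons t w ih => simp [ih]

@[simp] lemma vars_nil : vars ([] : List (T ⊕ α)) = [] := rfl

@[simp] lemma vars_inl (t : T) (C : List (T ⊕ α)) : vars (Sum.inl t :: C) = vars C := rfl

@[simp] lemma vars_inr (x : α) (C : List (T ⊕ α)) : vars (Sum.inr x :: C) = x :: vars C := rfl

@[simp] lemma vars_append (C D : List (T ⊕ α)) : vars (C ++ D) = vars C ++ vars D := by
  simp [vars]

@[simp] lemma vars_map_inl (w : List T) : vars (w.map Sum.inl : List (T ⊕ α)) = [] := by
  induction w with
  | nil => rfl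
  | cons t w ih => simp [ih]

@[simp] lemma terminals_nil : terminals ([] : List (T ⊕ α)) = [] := rfl

@[simp] lemma terminals_inl (t : T) (C : List (T ⊕ α)) :
    terminals (Sum.inl t :: C) = t :: terminals C := rfl

@[simp] lemma terminals_inr (x : α) (C : List (T ⊕ α)) :
    terminals (Sum.inr x :: C) = terminals C := rfl

lemma fill_subst (C : List (T ⊕ α)) (σ : α → List (T ⊕ β)) (v : β → List T) :
    fill (subst C σ) v = fill C (fun x => fill (σ x) v) := by
  induction C with
  | nil => rfl
  | cons c C ih =>
    have h : subst (c :: C) σ = Sum.elim (fun t => [Sum.inl t]) σ c ++ subst C σ := rfl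
    cases c <;> simp [h, ih]

lemma vars_subst (C : List (T ⊕ α)) (σ : α → List (T ⊕ β)) :
    vars (subst C σ) = (vars C).flatMap (fun x => vars (σ x)) := by
  induction C with
  | nil => rfl
  | cons c C ih =>
    have h : subst (c :: C) σ = Sum.elim (fun t => [Sum.inl t]) σ c ++ subst C σ := rfl
    cases c <;> simp [h, ih]

lemma vars_flatMap {γ : Type*} (l : List γ) (f : γ → List (T ⊕ α)) :
    vars (l.flatMap f) = l.flatMap (fun x => vars (f x)) := by
  induction l with
  | nil => rfl
  | cons c C ih => simp [ih]

lemma fill_flatMap {γ : Type*} (l : List γ) (f : γ → List (T ⊕ α)) (v : α → List T) :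
    fill (l.flatMap f) v = l.flatMap (fun x => fill (f x) v) := by
  induction l with
  | nil => rfl
  | cons c C ih => simp [ih]

/-- The letters of a filled template come from the template or from the values. -/
lemma fill_perm (C : List (T ⊕ α)) (v : α → List T) :
    (fill C v).Perm (terminals C ++ (vars C).flatMap v) := by
  induction C with
  | nil => rfl
  | cons c C ih =>
    cases c with
    | inl t => simpa using ih
    | inr x =>
      simp only [fill_inr, terminals_inr, vars_inr, List.flatMap_cons]
      refine (ih.append_left (v x)).trans ?_
      rw [← List.append_assoc, ← List.append_assoc]
      exact List.perm_append_comm.append_right _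

lemma length_fill (C : List (T ⊕ α)) (v : α → List T) :
    (fill C v).length = (terminals C).length + ((vars C).flatMap v).length := by
  simpa using (fill_perm C v).length_eq

end LinearTemplate

lemma List.Nodup.sum_map_le_sum_univ {α : Type*} [Fintype α] {l : List α} (hl : l.Nodup)
    (f : α → ℕ) : (l.map f).sum ≤ ∑ x, f x := by
  classical
  rw [← List.sum_toFinset f hl]
  exact Finset.sum_le_sum_of_subset (Finset.subset_univ _)

lemma List.Nodup.flatMap_of_finRange {β : Type*} {k : ℕ} {l : List (Fin k)} (hl : l.Nodup)
    {f : Fin k → List β} (hf : ((List.finRange k).flatMap f).Nodup) : (l.flatMap f).Nodup := by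
  rw [List.nodup_flatMap] at hf ⊢
  refine ⟨fun x _ => hf.1 x (List.mem_finRange x), ?_⟩
  refine hl.pairwise_of_forall_ne fun x _ y _ hxy => ?_
  have hsymm : Std.Symm (Function.onFun List.Disjoint f) := ⟨fun _ _ h => List.Disjoint.symm h⟩
  exact hf.2.forall (List.mem_finRange x) (List.mem_finRange y) hxy

/-! ### Alternation between context letters and value letters -/

section ColourChanges

/-- The number of colour changes in a list of colours that is read after the colour `b`. -/
def colourChanges : Bool → List Bool → ℕ
  | _, [] => 0
  | b, c :: l => (if b = c then 0 else 1) + colourChanges c l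

lemma exists_colourChanges_le_append (b : Bool) (l r : List Bool) :
    ∃ c, colourChanges c r ≤ colourChanges b (l ++ r) := by
  induction l generalizing b with
  | nil => exact ⟨b, le_rfl⟩
  | cons d l ih =>
    obtain ⟨c, hc⟩ := ih d
    exact ⟨c, hc.trans (Nat.le_add_left _ _)⟩

/-- The witness `c` plays the role of the last colour read in `l`; meeting `!b` costs a change
before `r` begins. -/
lemma exists_colourChanges_lt_append (b : Bool) (l r : List Bool) (h : (!b) ∈ l) :
    ∃ c, colourChanges c r < colourChanges b (l ++ r) := by
  induction l generalizing b with
  | nil => simp at h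
  | cons d l ih =>
    by_cases hd : b = d
    · subst hd
      obtain ⟨c, hc⟩ := ih b (by simpa using h)
      exact ⟨c, hc.trans_le (Nat.le_add_left _ _)⟩
    · obtain ⟨c, hc⟩ := exists_colourChanges_le_append d l r
      refine ⟨c, ?_⟩
      simp only [List.cons_append, colourChanges, hd, if_false]
      omega

lemma colourChanges_true_replicate_append (k : ℕ) (l : List Bool) :
    colourChanges true (List.replicate k true ++ l) = colourChanges true l := by
  induction k with
  | zero => simp
  | succ k ih => simpa [List.replicate_succ, colourChanges] using ih

lemma colourChanges_replicate_true_append_le (k : ℕ) (b : Bool) (l : List Bool) :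
    colourChanges b (List.replicate k true ++ l) ≤
      max (colourChanges b l) (1 + colourChanges true l) := by
  cases k with
  | zero => simp
  | succ k =>
    cases b <;> simp [List.replicate_succ, colourChanges, colourChanges_true_replicate_append]

/-- A word made of one block for each letter of `ls`, in which every block has both colours, has
at least as many colour changes as blocks. -/
lemma length_le_colourChanges {T : Type*} (n : ℕ) (ls : List T) (hls : ls.Nodup)
    (W : List (T × Bool)) (hW : W.map Prod.fst = ls.flatMap (List.replicate n))
    (h : ∀ t ∈ ls, ∀ c, (t, c) ∈ W) (b : Bool) :
    ls.length ≤ colourChanges b (W.map Prod.snd) := by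
  induction ls generalizing W b with
  | nil => simp
  | cons t ls ih =>
    rw [List.flatMap_cons, List.map_eq_append_iff] at hW
    obtain ⟨W₁, W₂, rfl, h₁, h₂⟩ := hW
    rw [List.nodup_cons] at hls
    have hfst₁ : ∀ x ∈ W₁, x.1 = t := fun x hx =>
      List.eq_of_mem_replicate (h₁ ▸ List.mem_map_of_mem hx)
    have hfst₂ : ∀ x ∈ W₂, x.1 ∈ ls := fun x hx => by
      have : x.1 ∈ ls.flatMap (List.replicate n) := h₂ ▸ List.mem_map_of_mem hx
      obtain ⟨s, hs, hx⟩ := List.mem_flatMap.1 this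
      exact List.eq_of_mem_replicate hx ▸ hs
    -- The letter `t` has both colours and occurs only in the first block, so whatever `b` is, this
    -- block forces a change.
    have hmem : (!b) ∈ W₁.map Prod.snd := by
      rcases List.mem_append.1 (h t (by simp) (!b)) with hb | hb
      · exact List.mem_map_of_mem (f := Prod.snd) hb
      · exact absurd (hfst₂ _ hb) hls.1
    obtain ⟨c, hc⟩ := exists_colourChanges_lt_append b _ (W₂.map Prod.snd) hmem
    have := ih hls.2 W₂ h₂ (fun s hs d => by
      rcases List.mem_append.1 (h s (by simp [hs]) d) with hb | hb
      · exact absurd (hfst₁ _ hb ▸ hs) hls.1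
      · exact hb) c
    rw [List.map_append, List.length_cons]
    omega

namespace LinearTemplate

variable {T α : Type*}

/-- The filled template with the letters that come from values of variables coloured `true`. -/
def colouredFill (C : List (T ⊕ α)) (v : α → List T) : List (T × Bool) :=
  C.flatMap (Sum.elim (fun t => [(t, false)]) (fun x => (v x).map (fun t => (t, true))))

lemma map_fst_colouredFill (C : List (T ⊕ α)) (v : α → List T) :
    (colouredFill C v).map Prod.fst = fill C v := by
  induction C with
  | nil => rfl
  | cons c C ih =>
    rw [colouredFill, List.flatMap_cons, List.map_append, ← colouredFill, ih]
    cases c <;> simp [Function.comp_def]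

/-- Each variable costs at most one change on entering its value and one on leaving it; `b.toNat`
pays for leaving `true` when reading starts in that colour. -/
lemma colourChanges_colouredFill_le (C : List (T ⊕ α)) (v : α → List T) (b : Bool) :
    colourChanges b ((colouredFill C v).map Prod.snd) ≤ 2 * (vars C).length + b.toNat := by
  induction C generalizing b with
  | nil => simp [colouredFill, colourChanges]
  | cons c C ih =>
    rw [colouredFill, List.flatMap_cons, List.map_append, ← colouredFill]
    cases c with
    | inl t =>
      have := ih false
      cases b <;> simp [colourChanges] at this ⊢ <;> omega
    | inr x =>
      have h₁ := ih b
      have h₂ := ih true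
      have h₃ := colourChanges_replicate_true_append_le (v x).length b
        ((colouredFill C v).map Prod.snd)
      have h₄ : ((v x).map (fun t => (t, true))).map Prod.snd
          = List.replicate (v x).length true := by
        simp [Function.comp_def]
      simp only [Sum.elim_inr, h₄, vars_inr, List.length_cons, Bool.toNat_true] at *
      omega

lemma mem_terminals_iff (C : List (T ⊕ α)) (v : α → List T) (t : T) :
    t ∈ terminals C ↔ (t, false) ∈ colouredFill C v := by
  simp [terminals, colouredFill]

lemma mem_flatMap_vars_iff (C : List (T ⊕ α)) (v : α → List T) (t : T) :
    t ∈ (vars C).flatMap v ↔ (t, true) ∈ colouredFill C v := by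
  simp [vars, colouredFill]

/-- If a template with few variables fills to a word with many blocks, then some letter occurs only
in the values or only in the template. -/
lemma exists_letter_not_mem (n : ℕ) (ls : List T) (hls : ls.Nodup) (C : List (T ⊕ α))
    (v : α → List T) (hC : fill C v = ls.flatMap (List.replicate n))
    (hlen : 2 * (vars C).length < ls.length) :
    ∃ t, ∃ b : Bool, if b then t ∉ (vars C).flatMap v else t ∉ terminals C := by
  by_contra! hcon
  have h := length_le_colourChanges n ls hls (colouredFill C v)
    ((map_fst_colouredFill C v).trans hC) (fun t _ c => by
      have := hcon t c
      cases c
      · simpa [mem_terminals_iff C v] using this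
      · simpa only [if_true, not_not, mem_flatMap_vars_iff] using this) false
  have h' := colourChanges_colouredFill_le C v false
  simp only [Bool.toNat_false] at h'
  omega

end LinearTemplate

end ColourChanges

/-! ### Passing contexts from the head of a rule to its body -/

namespace MCFRule

open LinearTemplate

variable {T : Type u} {N : Type} {rank : N → ℕ}

lemma apply_eq_fill (r : MCFRule T rank)
    (v : (i : Fin r.arity) → Fin (rank (r.body i)) → List T) :
    r.apply v = fun j => fill (r.output j) (fun x => v x.1 x.2) := rfl

/-- The variable `x`, if it belongs to the `i`-th non-terminal on the right of the rule. -/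
def component (r : MCFRule T rank) (i : Fin r.arity)
    (x : Σ i : Fin r.arity, Fin (rank (r.body i))) : Option (Fin (rank (r.body i))) :=
  if h : x.1 = i then some (h ▸ x.2) else none

@[simp] lemma component_self (r : MCFRule T rank) (i : Fin r.arity)
    (j : Fin (rank (r.body i))) : r.component i ⟨i, j⟩ = some j := by
  simp [component]

lemma component_of_ne (r : MCFRule T rank) {i k : Fin r.arity} (h : k ≠ i)
    (j : Fin (rank (r.body k))) : r.component i ⟨k, j⟩ = none := by
  simp [component, h]

lemma component_inj (r : MCFRule T rank) (i : Fin r.arity)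
    (x y : Σ i : Fin r.arity, Fin (rank (r.body i))) (j : Fin (rank (r.body i)))
    (hx : j ∈ r.component i x) (hy : j ∈ r.component i y) : x = y := by
  obtain ⟨k, x⟩ := x
  obtain ⟨l, y⟩ := y
  by_cases hk : k = i
  · by_cases hl : l = i
    · subst hk hl
      simp_all
    · simp [component_of_ne r hl] at hy
  · simp [component_of_ne r hk] at hx

/-- The substitution that keeps the variables of the `i`-th non-terminal on the right and gives
values to all others. -/
def restrict (r : MCFRule T rank) (v : (i : Fin r.arity) → Fin (rank (r.body i)) → List T)
    (i : Fin r.arity) (x : Σ i : Fin r.arity, Fin (rank (r.body i))) :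
    List (T ⊕ Fin (rank (r.body i))) :=
  match r.component i x with
  | some j => [Sum.inr j]
  | none => (v x.1 x.2).map Sum.inl

lemma fill_restrict (r : MCFRule T rank)
    (v : (i : Fin r.arity) → Fin (rank (r.body i)) → List T) (i : Fin r.arity)
    (w : Fin (rank (r.body i)) → List T) (x : Σ i : Fin r.arity, Fin (rank (r.body i))) :
    fill (r.restrict v i x) w = Function.update v i w x.1 x.2 := by
  obtain ⟨k, j⟩ := x
  by_cases hk : k = i
  · subst hk
    simp [restrict]
  · simp [restrict, component_of_ne r hk, hk]

lemma vars_restrict (r : MCFRule T rank)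
    (v : (i : Fin r.arity) → Fin (rank (r.body i)) → List T) (i : Fin r.arity)
    (x : Σ i : Fin r.arity, Fin (rank (r.body i))) :
    vars (r.restrict v i x) = (r.component i x).toList := by
  unfold restrict
  cases r.component i x <;> simp

lemma flatMap_vars_restrict (r : MCFRule T rank)
    (v : (i : Fin r.arity) → Fin (rank (r.body i)) → List T) (i : Fin r.arity)
    (l : List (Σ i : Fin r.arity, Fin (rank (r.body i)))) :
    l.flatMap (fun x => vars (r.restrict v i x)) = l.filterMap (r.component i) := by
  simp only [vars_restrict]
  induction l with
  | nil => rfl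
  | cons x l ih => cases h : r.component i x <;> simp [h, ih]

/-- The values of the variables in a list, sorted by the non-terminals they belong to. -/
lemma length_flatMap_eq_sum (r : MCFRule T rank)
    (v : (i : Fin r.arity) → Fin (rank (r.body i)) → List T)
    (l : List (Σ i : Fin r.arity, Fin (rank (r.body i)))) :
    (l.flatMap (fun x => v x.1 x.2)).length
      = ∑ i, ((l.filterMap (r.component i)).flatMap (v i)).length := by
  induction l with
  | nil => simp
  | cons x l ih =>
    obtain ⟨k, j⟩ := x
    have h : ∀ i, (((⟨k, j⟩ :: l).filterMap (r.component i)).flatMap (v i)).length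
        = (if i = k then (v k j).length else 0)
          + ((l.filterMap (r.component i)).flatMap (v i)).length := by
      intro i
      by_cases hk : k = i
      · subst hk
        simp
      · simp [component_of_ne r hk, Ne.symm hk]
    rw [Finset.sum_congr rfl fun i _ => h i, Finset.sum_add_distrib, ← ih]
    simp

/-- The context of the `i`-th non-terminal on the right, given a context of the head. -/
def childContext (r : MCFRule T rank)
    (v : (i : Fin r.arity) → Fin (rank (r.body i)) → List T)
    (C : List (T ⊕ Fin (rank r.head))) (i : Fin r.arity) : List (T ⊕ Fin (rank (r.body i))) :=
  subst (subst C r.output) (r.restrict v i)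

lemma fill_childContext (r : MCFRule T rank)
    (v : (i : Fin r.arity) → Fin (rank (r.body i)) → List T)
    (C : List (T ⊕ Fin (rank r.head))) (i : Fin r.arity) (w : Fin (rank (r.body i)) → List T) :
    fill (r.childContext v C i) w = fill C (r.apply (Function.update v i w)) := by
  rw [childContext, fill_subst, fill_subst, apply_eq_fill]
  simp only [fill_restrict]

lemma nodup_flatMap_vars_output (r : MCFRule T rank) {l : List (Fin (rank r.head))}
    (hl : l.Nodup) : (l.flatMap (fun j => vars (r.output j))).Nodup := by
  refine hl.flatMap_of_finRange ?_
  have h : (vars (List.ofFn r.output).flatten).Nodup := r.linear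
  rwa [List.ofFn_eq_map, ← List.flatMap_def, vars_flatMap] at h

lemma vars_childContext (r : MCFRule T rank)
    (v : (i : Fin r.arity) → Fin (rank (r.body i)) → List T)
    (C : List (T ⊕ Fin (rank r.head))) (i : Fin r.arity) :
    vars (r.childContext v C i)
      = ((vars C).flatMap (fun j => vars (r.output j))).filterMap (r.component i) := by
  rw [childContext, vars_subst, vars_subst, flatMap_vars_restrict]

/-- Linearity of the rule enters here. Distinctness is what bounds the number of variables of a
context by the rank. -/
lemma nodup_vars_childContext (r : MCFRule T rank)
    (v : (i : Fin r.arity) → Fin (rank (r.body i)) → List T)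
    {C : List (T ⊕ Fin (rank r.head))} (hC : (vars C).Nodup) (i : Fin r.arity) :
    (vars (r.childContext v C i)).Nodup := by
  rw [vars_childContext]
  exact (r.nodup_flatMap_vars_output hC).filterMap (r.component_inj i)

/-- The letters that a value contributes come from the rule or from the values of the children. -/
lemma length_flatMap_apply_le (r : MCFRule T rank)
    (v : (i : Fin r.arity) → Fin (rank (r.body i)) → List T)
    {C : List (T ⊕ Fin (rank r.head))} (hC : (vars C).Nodup) :
    ((vars C).flatMap (r.apply v)).length ≤ ∑ j, (r.output j).length
      + ∑ i, ((vars (r.childContext v C i)).flatMap (v i)).length := by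
  rw [apply_eq_fill, ← fill_flatMap, length_fill, length_flatMap_eq_sum, vars_flatMap]
  simp only [vars_childContext]
  refine Nat.add_le_add_right ?_ _
  calc (terminals ((vars C).flatMap r.output)).length
      ≤ ((vars C).flatMap r.output).length := List.length_filterMap_le _ _
    _ = ((vars C).map fun j => (r.output j).length).sum := List.length_flatMap
    _ ≤ _ := hC.sum_map_le_sum_univ _

end MCFRule

/-! ### Splitting derivations -/

namespace MultipleContextFreeGrammar

open LinearTemplate

variable {T : Type u}

/-- A context of `A` is a string with distinct variables that turns every value of `A` into a word
of the language. -/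
structure IsContext (g : MultipleContextFreeGrammar T) (A : g.NT)
    (C : List (T ⊕ Fin (g.rank A))) : Prop where
  nodup : (vars C).Nodup
  fill_mem : ∀ v, g.Derives A v → fill C v ∈ g.language

/-- Changing the value of one child while keeping the other derived values gives another derivable
value of the head. -/
lemma IsContext.child {g : MultipleContextFreeGrammar T} {r : MCFRule T g.rank}
    (hr : r ∈ g.rules) {v : (i : Fin r.arity) → Fin (g.rank (r.body i)) → List T}
    (hv : ∀ i, g.Derives (r.body i) (v i)) {C : List (T ⊕ Fin (g.rank r.head))}
    (hC : g.IsContext r.head C) (i : Fin r.arity) :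
    g.IsContext (r.body i) (r.childContext v C i) where
  nodup := r.nodup_vars_childContext v hC.nodup i
  fill_mem w hw := by
    rw [r.fill_childContext]
    refine hC.fill_mem _ (.rule r hr _ fun k => ?_)
    by_cases hk : k = i
    · subst hk
      simpa using hw
    · simpa [hk] using hv k

/-- A derivation whose value contributes many letters contains a node whose value contributes a
number of letters in a prescribed range. -/
lemma exists_context_between (g : MultipleContextFreeGrammar T) (K : ℕ) :
    ∃ K', ∀ A v, g.Derives A v → ∀ C, g.IsContext A C → K ≤ ((vars C).flatMap v).length →
      ∃ B w D, g.Derives B w ∧ g.IsContext B D ∧ fill D w = fill C v ∧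
        K ≤ ((vars D).flatMap w).length ∧ ((vars D).flatMap w).length ≤ K' := by
  -- One rule adds at most its own output length to what its children contribute; if each child
  -- contributes less than `K`, the head stays within this bound. Only components used by the
  -- context are counted, since rules may discard some.
  refine ⟨g.rules.sup fun r => ∑ j, (r.output j).length + r.arity * K, fun A v h => ?_⟩
  induction h with
  | rule r hr v hv ih =>
    intro C hC hK
    by_cases hle : ((vars C).flatMap (r.apply v)).length
        ≤ g.rules.sup fun r => ∑ j, (r.output j).length + r.arity * K
    · exact ⟨r.head, _, C, .rule r hr v hv, hC, rfl, hK, hle⟩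
    · obtain ⟨i, hi⟩ : ∃ i, K ≤ ((vars (r.childContext v C i)).flatMap (v i)).length := by
        by_contra! hlt
        have h₁ := r.length_flatMap_apply_le v hC.nodup
        have h₂ := Finset.le_sup (f := fun r : MCFRule T g.rank =>
          ∑ j, (r.output j).length + r.arity * K) hr
        have h₃ : ∑ i, ((vars (r.childContext v C i)).flatMap (v i)).length ≤ r.arity * K := by
          simpa using Finset.sum_le_card_nsmul Finset.univ _ K fun i _ => (hlt i).le
        omega
      obtain ⟨B, w, D, hw, hD, heq, h⟩ := ih i _ (hC.child hr hv i) hi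
      refine ⟨B, w, D, hw, hD, heq.trans ?_, h⟩
      rw [r.fill_childContext, Function.update_eq_self]

/-- The trivial context of the start symbol. -/
lemma isContext_start (g : MultipleContextFreeGrammar T) :
    g.IsContext g.start [Sum.inr ⟨0, by simp [g.rank_start]⟩] where
  nodup := by simp
  fill_mem v hv := by
    have : (fun _ => v ⟨0, by simp [g.rank_start]⟩) = v := by
      funext j
      congr 1
      have := j.2
      have := g.rank_start
      exact Fin.ext (by simp only; omega)
    change g.Derives g.start (fun _ => fill _ v)
    simpa [this] using hv

/-- If the language has arbitrarily long words, then some of them split into a long context and a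
long value. -/
lemma exists_long_context (g : MultipleContextFreeGrammar T)
    (hg : ∀ K, ∃ w ∈ g.language, K ≤ w.length) (K : ℕ) :
    ∃ A v C, g.Derives A v ∧ g.IsContext A C ∧ K ≤ ((vars C).flatMap v).length ∧
      K ≤ (terminals C).length := by
  obtain ⟨K', hK'⟩ := g.exists_context_between K
  obtain ⟨w, hw, hlen⟩ := hg (K + K')
  -- The value takes at most `K'` of the `K + K'` letters, leaving at least `K` to the context.
  obtain ⟨B, v, D, hv, hD, heq, h₁, h₂⟩ :=
    hK' g.start (fun _ => w) hw _ g.isContext_start (by simp; omega)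
  refine ⟨B, v, D, hv, hD, h₁, ?_⟩
  have := length_fill D v
  rw [heq, fill_inr, fill_nil, List.append_nil] at this
  omega

end MultipleContextFreeGrammar

/-! ### Pigeonhole, letter counts and the theorem -/

lemma exists_forall_of_antitone {ι : Type*} [Finite ι] (P : ι → ℕ → Prop)
    (hP : ∀ i m n, m ≤ n → P i n → P i m) (h : ∀ n, ∃ i, P i n) : ∃ i, ∀ n, P i n := by
  by_contra! hcon
  choose f hf using hcon
  obtain ⟨M, hM⟩ := (Set.finite_range f).bddAbove
  obtain ⟨i, hi⟩ := h M
  exact hf i (hP i _ _ (hM ⟨i, rfl⟩) hi)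

lemma blockWord_eq_flatMap {T : Type*} {k : ℕ} (a : Fin k → T) (n : ℕ) :
    blockWord a n = (List.ofFn a).flatMap (List.replicate n) := by
  rw [List.flatMap_def, List.map_ofFn]
  rfl

lemma length_blockWord {T : Type*} {k : ℕ} (a : Fin k → T) (n : ℕ) :
    (blockWord a n).length = k * n := by
  simp [blockWord_eq_flatMap, List.length_flatMap, List.map_ofFn, Function.comp_def]

lemma count_blockWord {T : Type*} [DecidableEq T] {k : ℕ} (a : Fin k ≃ T) (n : ℕ) (t : T) :
    (blockWord a n).count t = n := by
  rw [blockWord, List.count_flatten, List.map_ofFn, List.sum_ofFn,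
    Finset.sum_eq_single (a.symm t)]
  · simp
  · intro i _ hi
    have : a i ≠ t := fun h => hi (by simp [← h])
    simp [List.count_replicate, this]
  · simp

/-- Two families of letter counts with a common zero whose sums with a fixed family are constant
agree, so the underlying words have the same length. -/
lemma length_eq_of_count_add_eq {T : Type*} [DecidableEq T] {l l' r : List T} {n n' : ℕ} {t : T}
    (h : ∀ s, r.count s + l.count s = n) (h' : ∀ s, r.count s + l'.count s = n')
    (ht : t ∉ l) (ht' : t ∉ l') : l.length = l'.length := by
  refine (List.perm_iff_count.2 fun s => ?_).length_eq
  have h₁ := h t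
  have h₂ := h' t
  rw [List.count_eq_zero_of_not_mem ht] at h₁
  rw [List.count_eq_zero_of_not_mem ht'] at h₂
  have := h s
  have := h' s
  omega

open LinearTemplate in
theorem lemma5p1 {T : Type*} (m : ℕ) (hm : 1 ≤ m) (a : Fin (2 * m + 1) ≃ T) :
    ¬ Language.IsMultipleContextFree m ({w | ∃ n : ℕ, w = blockWord a n} : Language T) := by
  classical
  rintro ⟨g, hrank, hlang⟩
  have hmem : ∀ w, w ∈ g.language ↔ ∃ n, w = blockWord a n := fun w => by rw [hlang]; rfl
  have : Finite g.NT := g.finite_NT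
  have : Finite T := Finite.of_equiv _ a
  have hlong : ∀ K, ∃ w ∈ g.language, K ≤ w.length := fun K =>
    ⟨blockWord a K, (hmem _).2 ⟨K, rfl⟩, by rw [length_blockWord]; nlinarith⟩
  -- The index type is finite because duplicate-free lists over a finite type are. Fixing the list
  -- `l` makes all contexts use the same components.
  obtain ⟨⟨A, ⟨l, hl⟩, t, b⟩, h⟩ := exists_forall_of_antitone
    (ι := Σ A : g.NT, {l : List (Fin (g.rank A)) // l.Nodup} × T × Bool)
    (fun i K => ∃ v C, g.Derives i.1 v ∧ g.IsContext i.1 C ∧ vars C = i.2.1 ∧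
      K ≤ ((vars C).flatMap v).length ∧ K ≤ (terminals C).length ∧
      if i.2.2.2 then i.2.2.1 ∉ (vars C).flatMap v else i.2.2.1 ∉ terminals C)
    (fun i K K' hK ⟨v, C, hv, hC, hi, h₁, h₂, h₃⟩ =>
      ⟨v, C, hv, hC, hi, hK.trans h₁, hK.trans h₂, h₃⟩)
    (fun K => by
      obtain ⟨A, v, C, hv, hC, h₁, h₂⟩ := g.exists_long_context hlong K
      obtain ⟨n, hn⟩ := (hmem _).1 (hC.fill_mem v hv)
      have hlen : (vars C).length ≤ m := by
        have := hC.nodup.length_le_card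
        rw [Fintype.card_fin] at this
        exact this.trans (hrank A)
      obtain ⟨t, b, ht⟩ := exists_letter_not_mem n (List.ofFn a)
        (List.nodup_ofFn.2 a.injective) C v (hn.trans (blockWord_eq_flatMap _ _))
        (by rw [List.length_ofFn]; omega)
      exact ⟨⟨A, ⟨vars C, hC.nodup⟩, t, b⟩, v, C, hv, hC, rfl, h₁, h₂, ht⟩)
  have hcount : ∀ C v, g.IsContext A C → g.Derives A v → ∃ n, ∀ s,
      (terminals C).count s + ((vars C).flatMap v).count s = n := fun C v hC hv => by
    obtain ⟨n, hn⟩ := (hmem _).1 (hC.fill_mem v hv)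
    refine ⟨n, fun s => ?_⟩
    rw [← List.count_append, ← (fill_perm C v).count_eq, hn, count_blockWord]
  obtain ⟨v, C, hv, hC, hvars, -, -, ht⟩ := h 0
  obtain ⟨v', C', hv', hC', hvars', h₁, h₂, ht'⟩ :=
    -- This threshold exceeds both parts of the first split, so it serves either side.
    h (((vars C).flatMap v).length + (terminals C).length + 1)
  simp only at hvars hvars' hv hv' hC hC' ht ht'
  have hCC : vars C' = vars C := hvars'.trans hvars.symm
  cases b with
  | true =>
    simp only [if_true] at ht ht'
    obtain ⟨n, hn⟩ := hcount C v hC hv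
    -- The old context is filled with the new, longer value.
    obtain ⟨n', hn'⟩ := hcount C v' hC hv'
    have := length_eq_of_count_add_eq hn hn' ht (hCC ▸ ht')
    rw [hCC] at h₁
    omega
  | false =>
    simp only [Bool.false_eq_true, if_false] at ht ht'
    obtain ⟨n, hn⟩ := hcount C v hC hv
    -- Dually, the old value is put into the new, longer context.
    obtain ⟨n', hn'⟩ := hcount C' v hC' hv
    rw [hCC] at hn'
    have := length_eq_of_count_add_eq (fun s => (Nat.add_comm _ _).trans (hn s))
      (fun s => (Nat.add_comm _ _).trans (hn' s)) ht ht'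
    omega
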